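/- Let $\mathcal L=\{(n,m)\in\mathbb Z^2: n\ge 0,\ n+m \text{ even}\}$ and $p\in[0,1]$. Under $\mathbb P=\mathbb P_p$ the sites of $\mathcal L$ are independently occupied, each with probability $p$. An occupied site $(n,m)\in\mathcal L$ is joined by directed edges to $(n+1,m+1)$, $(n+2,m)$ and $(n+1,m-1)$; a site that is not occupied has no outgoing edges. Write $z\to w$ if there is a directed path of length $\ge 0$ from $z$ to $w$, and let $\mathbf C_o=\{w: o\to w\}$ be the forward cluster of the origin $o=(0,0)$. For $n\ge 1$ let $$\overline u_n=\sup\{x:\ \exists\, y\le 0 \text{ such that } (0,y)\to(n,x) \text{ or } (1,y)\to(n,x)\}\in[-\infty,n],$$ where all sites are taken in $\mathcal L$ and $\sup\varnothing=-\infty$, and define the edge speed $$\alpha=\alpha[p]=\inf_{n\ge 1}\mathbb E\Big[\frac{\overline u_n}{n}\Big]\in[-\infty,1].$$ Lemma. If $\alpha>0$, then $\mathbb P(|\mathbf C_o|=\infty)>0$. -/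

import Mathlib

open MeasureTheory
open scoped ENNReal

namespace OrientedPercolation

/-- The lattice `{(n, m) ∈ ℤ² : n ≥ 0, n + m even}`. -/
def lattice : Set (ℤ × ℤ) := {z | 0 ≤ z.1 ∧ Even (z.1 + z.2)}

/-- A site configuration: `ω z = true` means that the site `z` is occupied. Only the sites in
`lattice` ever matter, see `Step`. -/
abbrev Config : Type := ℤ × ℤ → Bool

/-- The law under which the sites are independently occupied, each with probability `p`. -/
noncomputable def siteLaw (p : unitInterval) : Measure Config :=
  Measure.infinitePi fun _ => ProbabilityTheory.bernoulliMeasure true false p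

instance (p : unitInterval) : IsProbabilityMeasure (siteLaw p) := by
  unfold siteLaw
  infer_instance

/-- One step of an open path: an occupied lattice site `(n, m)` leads to each of
`(n + 1, m + 1)`, `(n + 2, m)` and `(n + 1, m - 1)`. These are again lattice sites. -/
def Step (ω : Config) (z w : ℤ × ℤ) : Prop :=
  z ∈ lattice ∧ ω z = true ∧
    (w = (z.1 + 1, z.2 + 1) ∨ w = (z.1 + 2, z.2) ∨ w = (z.1 + 1, z.2 - 1))

/-- `z → w`: there is a finite path of `k ≥ 0` steps from `z` to `w`. In particular every site
is connected to itself, and the last site of a path need not be occupied. -/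
def Connects (ω : Config) (z w : ℤ × ℤ) : Prop := Relation.ReflTransGen (Step ω) z w

/-- The forward cluster of `z`. -/
def forwardCluster (ω : Config) (z : ℤ × ℤ) : Set (ℤ × ℤ) := {w | Connects ω z w}

/-- The heights at level `n` that are reached from a lattice site `(0, y)` or `(1, y)`
with `y ≤ 0`. -/
def reachedFromBelow (ω : Config) (n : ℕ) : Set ℤ :=
  {x | ∃ y : ℤ, y ≤ 0 ∧
    (((0, y) ∈ lattice ∧ Connects ω (0, y) ((n : ℤ), x)) ∨
      ((1, y) ∈ lattice ∧ Connects ω (1, y) ((n : ℤ), x)))}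

/-- The highest point at level `n` that is reached from below the origin; the supremum is taken
in `[-∞, ∞]`, so it is `-∞` if there is no such point. -/
noncomputable def upperEdge (n : ℕ) (ω : Config) : EReal :=
  ⨆ x ∈ reachedFromBelow ω n, ((x : ℝ) : EReal)

/-- The expectation `E[X⁺] - E[X⁻] ∈ [-∞, ∞]` of an extended-real random variable. It is only
used for `X` that are bounded above by a constant, so that `E[X⁺] < ∞`. -/
noncomputable def extExpectation {Ω : Type*} [MeasurableSpace Ω] (P : Measure Ω)
    (X : Ω → EReal) : EReal :=
  ((∫⁻ ω, (X ω).toENNReal ∂P : ℝ≥0∞) : EReal) - ((∫⁻ ω, (-X ω).toENNReal ∂P : ℝ≥0∞) : EReal)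

/-- The edge speed `α[p] = inf_{n ≥ 1} E[upperEdge n / n]`, an element of `[-∞, 1]`. -/
noncomputable def edgeSpeed (p : unitInterval) : EReal :=
  ⨅ n : ℕ, ⨅ _ : 1 ≤ n, extExpectation (siteLaw p) fun ω => upperEdge n ω / ((n : ℝ) : EReal)

end OrientedPercolation

/-! A positive drift forces the upper edge `r` to make many last exits. The edge rises by at most
one per level, so `r N` is at most the number of `k < N` such that the edge stays at or above `r k`
up to level `N` (`le_card_last_exits`). At such a `k` the system restarted from the half line of
height `r k` satisfies `Stays` for `N - k` levels. The position of the edge and the restarted system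
use disjoint sets of sites, so this has probability at most `q (N - k)`, where `q n` is the
probability of `Stays 0 0 n` (`siteLaw_lastExit_le`). Hence the mean of `r N / N` is at most the
average of `q 1, …, q N`. Since `q` is antitone, a positive edge speed bounds it below by some `a >
0` (`exists_le_siteLaw_stays`).

The event reflected in the time axis has the same probability and both are increasing, so Harris'
inequality gives them joint probability at least `a ^ 2` (`siteLaw_sq_le`). When both occur,
planarity forces the origin to reach level `n` (`exists_connects_of_stays`). Continuity from above
in `n` finishes the proof. -/

namespace OrientedPercolation

/-! ### Paths and wet sites -/

/-- The site `w` is reached from a site of `S`. -/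
def Wet (ω : Config) (S : Set (ℤ × ℤ)) (w : ℤ × ℤ) : Prop := ∃ s ∈ S, Connects ω s w

/-- The lattice sites at levels `k` and `k + 1` of height at most `v`. -/
def halfLine (k v : ℤ) : Set (ℤ × ℤ) := {s | s ∈ lattice ∧ (s.1 = k ∨ s.1 = k + 1) ∧ s.2 ≤ v}

/-- The path system started below height `v` at level `k` has a wet site of height at least `v`
at each of the levels `k, …, k + n`. -/
def Stays (k v : ℤ) (n : ℕ) (ω : Config) : Prop :=
  ∀ i : ℕ, i ≤ n → ∃ x, v ≤ x ∧ Wet ω (halfLine k v) (k + i, x)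

lemma Step.mem_lattice {ω : Config} {z w : ℤ × ℤ} (h : Step ω z w) : w ∈ lattice := by
  obtain ⟨⟨h0, h1⟩, -, rfl | rfl | rfl⟩ := h <;> refine ⟨?_, ?_⟩ <;> simp only <;>
    first | omega | (rw [Int.even_iff] at *; omega)

lemma Step.bounds {ω : Config} {z w : ℤ × ℤ} (h : Step ω z w) :
    z.1 < w.1 ∧ |w.2 - z.2| ≤ w.1 - z.1 := by
  obtain ⟨-, -, rfl | rfl | rfl⟩ := h <;> refine ⟨?_, ?_⟩ <;> simp

lemma Connects.bounds {ω : Config} {z w : ℤ × ℤ} (h : Connects ω z w) :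
    z.1 ≤ w.1 ∧ |w.2 - z.2| ≤ w.1 - z.1 := by
  induction h with
  | refl => simp
  | tail _ h ih =>
    have := h.bounds
    rw [abs_le] at *
    omega

lemma Connects.mem_lattice {ω : Config} {z w : ℤ × ℤ} (h : Connects ω z w) (hz : z ∈ lattice) :
    w ∈ lattice := by
  induction h with
  | refl => exact hz
  | tail _ h _ => exact h.mem_lattice

/-- Connections to `w` only use the occupied sites in the backward light cone of `w`. -/
lemma Connects.congr {ω ω' : Config} {z w : ℤ × ℤ} (h : Connects ω z w)
    (hω : ∀ q : ℤ × ℤ, z.1 ≤ q.1 → q.1 < w.1 → |q.2 - w.2| ≤ w.1 - q.1 → ω q = true →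
      ω' q = true) : Connects ω' z w := by
  induction h using Relation.ReflTransGen.head_induction_on with
  | refl => exact .refl
  | head h h' ih =>
    have h1 := h.bounds
    have h2 := Connects.bounds h'
    refine .head ⟨h.1, hω _ le_rfl (by omega) ?_ h.2.1, h.2.2⟩
      (ih fun q hq => hω q (by omega))
    rw [abs_le] at *
    omega

lemma Connects.mono {ω ω' : Config} (hω : ω ≤ ω') {z w : ℤ × ℤ} (h : Connects ω z w) :
    Connects ω' z w :=
  h.congr fun q _ _ _ hq => by
    have := hω q
    rw [hq] at this
    exact top_le_iff.1 this

lemma Wet.tail {ω : Config} {S : Set (ℤ × ℤ)} {z w : ℤ × ℤ} (h : Wet ω S z) (h' : Step ω z w) :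
    Wet ω S w := by
  obtain ⟨s, hs, h⟩ := h
  exact ⟨s, hs, Relation.ReflTransGen.tail h h'⟩

lemma Wet.of_mem {ω : Config} {S : Set (ℤ × ℤ)} {w : ℤ × ℤ} (h : w ∈ S) : Wet ω S w :=
  ⟨w, h, .refl⟩

lemma Wet.cases {ω : Config} {S : Set (ℤ × ℤ)} {w : ℤ × ℤ} (h : Wet ω S w) :
    w ∈ S ∨ ∃ z, Wet ω S z ∧ Step ω z w := by
  obtain ⟨s, hs, h⟩ := h
  rcases Relation.ReflTransGen.cases_tail h with rfl | ⟨z, hz, hzw⟩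
  · exact .inl hs
  · exact .inr ⟨z, ⟨s, hs, hz⟩, hzw⟩

lemma Wet.mem_lattice {ω : Config} {k v : ℤ} {w : ℤ × ℤ} (h : Wet ω (halfLine k v) w) :
    w ∈ lattice := by
  obtain ⟨s, hs, h⟩ := h
  exact h.mem_lattice hs.1

lemma Wet.bounds {ω : Config} {k v : ℤ} {w : ℤ × ℤ} (h : Wet ω (halfLine k v) w) :
    k ≤ w.1 ∧ w.2 ≤ v + (w.1 - k) := by
  obtain ⟨s, ⟨-, h1, h2⟩, h⟩ := h
  have := h.bounds
  rw [abs_le] at this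
  omega

lemma Wet.congr {ω ω' : Config} {k v : ℤ} {w : ℤ × ℤ} (h : Wet ω (halfLine k v) w)
    (hω : ∀ q : ℤ × ℤ, k ≤ q.1 → q.1 < w.1 → |q.2 - w.2| ≤ w.1 - q.1 → ω q = true →
      ω' q = true) : Wet ω' (halfLine k v) w := by
  obtain ⟨s, hs, h⟩ := h
  exact ⟨s, hs, h.congr fun q hq => hω q (by have := hs.2.1; omega)⟩

lemma Wet.mono {ω ω' : Config} (hω : ω ≤ ω') {S : Set (ℤ × ℤ)} {w : ℤ × ℤ} (h : Wet ω S w) :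
    Wet ω' S w := by
  obtain ⟨s, hs, h⟩ := h
  exact ⟨s, hs, h.mono hω⟩

lemma reachedFromBelow_eq (ω : Config) (n : ℕ) :
    reachedFromBelow ω n = {x | Wet ω (halfLine 0 0) ((n : ℤ), x)} := by
  ext x
  constructor
  · rintro ⟨y, hy, ⟨hl, h⟩ | ⟨hl, h⟩⟩
    · exact ⟨_, ⟨hl, .inl rfl, hy⟩, h⟩
    · exact ⟨_, ⟨hl, .inr rfl, hy⟩, h⟩
  · rintro ⟨⟨a, y⟩, ⟨hl, h | h, hy⟩, hc⟩
    · obtain rfl : a = 0 := h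
      exact ⟨y, hy, .inl ⟨hl, hc⟩⟩
    · obtain rfl : a = 1 := by simpa using h
      exact ⟨y, hy, .inr ⟨hl, hc⟩⟩

/-- If `v` bounds the wet heights at level `k`, then later wet sites are also reached from the
half line of height `v` at level `k`. -/
lemma Wet.restart {ω : Config} {k v : ℤ} (hk : 0 ≤ k)
    (hv : ∀ x, Wet ω (halfLine 0 0) (k, x) → x ≤ v) {w : ℤ × ℤ} (h : Wet ω (halfLine 0 0) w)
    (hw : k ≤ w.1) : Wet ω (halfLine k v) w := by
  obtain ⟨s, hs, h⟩ := h
  have key : ∀ w : ℤ × ℤ, Connects ω s w → w.1 = k → Wet ω (halfLine k v) w := fun w hc hwk =>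
    .of_mem ⟨hc.mem_lattice hs.1, .inl hwk, hv _ ⟨s, hs, by rw [← hwk]; exact hc⟩⟩
  induction h with
  | refl =>
    rcases hs.2.1 with h0 | h1
    · exact key _ .refl (by omega)
    · rcases eq_or_ne s.1 k with h2 | h2
      · exact key _ .refl h2
      · obtain rfl : k = 0 := by omega
        refine .of_mem ⟨hs.1, .inr h1, hs.2.2.trans (hv 0 (.of_mem ?_))⟩
        exact ⟨⟨le_rfl, by simp⟩, .inl rfl, le_rfl⟩
  | @tail z w hz h ih =>
    by_cases hzk : k ≤ z.1
    · exact (ih hzk).tail h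
    · obtain ⟨hl, ho, hw'⟩ := id h
      by_cases hwk : w.1 = k
      · exact key w (Relation.ReflTransGen.tail hz h) hwk
      · have hup : Wet ω (halfLine 0 0) (z.1 + 1, z.2 + 1) :=
          Wet.tail ⟨s, hs, hz⟩ ⟨hl, ho, .inl rfl⟩
        have hzk' : z.1 + 1 = k ∧ w = (z.1 + 2, z.2) := by
          rcases hw' with rfl | rfl | rfl <;> simp only at hw hwk <;> first | omega | skip
          exact ⟨by omega, rfl⟩
        rw [hzk'.1] at hup
        have := hv _ hup
        refine .of_mem ⟨h.mem_lattice, .inr ?_, ?_⟩ <;> rw [hzk'.2] <;> simp only <;> omega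

/-! ### The upper edge as an integer sequence -/

/-- A sequence of integers with upward increments at most one is bounded by the number of times
after which it never goes back below its present value. -/
lemma le_card_last_exits (f : ℕ → ℤ) (N : ℕ) (h0 : f 0 ≤ 0) (hf : ∀ k < N, f (k + 1) ≤ f k + 1) :
    f N ≤ ((Finset.range N).filter fun k => ∀ j, k ≤ j → j ≤ N → f k ≤ f j).card := by
  classical
  by_cases hN : f N ≤ 0
  · exact hN.trans (by positivity)
  push Not at hN
  have hlast : ∀ v : ℤ, 0 ≤ v → v < f N →
      ∃ k < N, f k = v ∧ ∀ j, k ≤ j → j ≤ N → v ≤ f j := by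
    intro v hv hvN
    -- The last time at or below `v`: since the next value exceeds `v` and increments are at most
    -- one, `f k = v`. Different `v` thus give different times.
    let k := Nat.findGreatest (fun k => f k ≤ v) N
    have hk : f k ≤ v :=
      Nat.findGreatest_spec (P := fun k => f k ≤ v) (Nat.zero_le N) (h0.trans hv)
    have hkN : k < N := lt_of_le_of_ne (Nat.findGreatest_le N) fun h => by
      rw [h] at hk; omega
    have hgt : ∀ j, k < j → j ≤ N → v < f j := fun j h1 h2 =>
      not_le.1 (Nat.findGreatest_is_greatest (P := fun k => f k ≤ v) h1 h2)
    have h1 := hgt (k + 1) (by omega) (by omega)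
    have h2 := hf k hkN
    refine ⟨k, hkN, by omega, fun j hj hjN => ?_⟩
    rcases hj.eq_or_lt with rfl | hj
    · omega
    · exact (hgt j hj hjN).le
  have : (Finset.Ico 0 (f N)).card ≤
      ((Finset.range N).filter fun k => ∀ j, k ≤ j → j ≤ N → f k ≤ f j).card := by
    refine (Finset.card_le_card fun v hv => ?_).trans (Finset.card_image_le (f := f))
    obtain ⟨k, hk, rfl, h⟩ := hlast v (Finset.mem_Ico.1 hv).1 (Finset.mem_Ico.1 hv).2
    exact Finset.mem_image.2 ⟨k, by simpa [hk] using h, rfl⟩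
  rw [Int.card_Ico] at this
  omega

/-- The wet heights at level `k` have maximum `v`. -/
def TopAt (k : ℕ) (v : ℤ) (ω : Config) : Prop :=
  IsGreatest {x | Wet ω (halfLine 0 0) ((k : ℤ), x)} v

lemma exists_topAt {ω : Config} {k N : ℕ} (hk : k ≤ N) {x : ℤ}
    (hx : Wet ω (halfLine 0 0) ((N : ℤ), x)) : ∃ v, TopAt k v ω := by
  by_cases hne : ({x | Wet ω (halfLine 0 0) ((k : ℤ), x)} : Set ℤ).Nonempty
  · have hb : BddAbove {x | Wet ω (halfLine 0 0) ((k : ℤ), x)} :=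
      ⟨k, fun y hy => by simpa using hy.bounds.2⟩
    exact ⟨_, Int.csSup_mem hne hb, fun y hy => le_csSup hb hy⟩
  · exfalso
    -- With no wet site at level `k`, every `v` is vacuously an upper bound; this one is too low for
    -- the light cone to reach height `x` at level `N`.
    have := (hx.restart (k := k) (v := x - 1 - (N - k)) (by positivity)
      (fun y hy => (hne ⟨y, hy⟩).elim) (by simpa using hk)).bounds.2
    simp only at this
    omega

/-- The last-exit times of the upper edge up to level `N`. -/
lemma le_card_topAt_stays {ω : Config} {N : ℕ} {x : ℤ}
    (hx : Wet ω (halfLine 0 0) ((N : ℤ), x)) (s : Finset ℕ)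
    (hs : ∀ k < N, ∀ v, TopAt k v ω → Stays k v (N - k) ω → k ∈ s) : x ≤ s.card := by
  classical
  have hex : ∀ k, ∃ v, k ≤ N → TopAt k v ω := fun k => by
    by_cases hk : k ≤ N
    · obtain ⟨v, hv⟩ := exists_topAt hk hx
      exact ⟨v, fun _ => hv⟩
    · exact ⟨0, fun h => (hk h).elim⟩
  choose f hf using hex
  refine ((hf N le_rfl).2 hx).trans
    ((le_card_last_exits f N ?_ fun k hk => ?_).trans (Nat.cast_le.2 (Finset.card_le_card ?_)))
  · simpa using (hf 0 N.zero_le).1.bounds.2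
  · have h1 : Wet ω (halfLine 0 0) (((k + 1 : ℕ) : ℤ), f (k + 1)) := (hf (k + 1) hk).1
    have := (h1.restart (k := k) (by positivity) (hf k hk.le).2 (by simp)).bounds.2
    simp at this
    omega
  · intro k hk
    obtain ⟨hkN, hk⟩ := Finset.mem_filter.1 hk
    have hkN := Finset.mem_range.1 hkN
    refine hs k hkN (f k) (hf k hkN.le) fun i hi => ⟨f (k + i), hk _ (by omega) (by omega), ?_⟩
    have h1 : Wet ω (halfLine 0 0) (((k + i : ℕ) : ℤ), f (k + i)) := (hf (k + i) (by omega)).1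
    have := h1.restart (k := k) (by positivity) (hf k hkN.le).2 (by simp)
    simpa using this

/-! ### Planarity -/

/-- A wet site that lies above the cluster of the origin belongs to that cluster. -/
lemma connects_origin_of_le {ω : Config} (n : ℕ) : ∀ c x : ℤ, Connects ω (0, 0) ((n : ℤ), c) →
    Wet ω (halfLine 0 0) ((n : ℤ), x) → c ≤ x → Connects ω (0, 0) ((n : ℤ), x) := by
  induction n using Nat.strong_induction_on with
  | _ n ih =>
    intro c x hc hx hcx
    have IH : ∀ (m c x : ℤ), m < n → Connects ω (0, 0) (m, c) → Wet ω (halfLine 0 0) (m, x) →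
        c ≤ x → Connects ω (0, 0) (m, x) := fun m c x hm hc hx hcx => by
      obtain ⟨m, rfl⟩ := Int.eq_ofNat_of_zero_le hx.bounds.1
      exact ih m (by omega) c x hc hx hcx
    rcases hcx.eq_or_lt with rfl | hlt
    · exact hc
    have hpx := hx.mem_lattice.2
    have hpc := (hc.mem_lattice ⟨le_rfl, by simp⟩).2
    have hcx2 : c + 2 ≤ x := by
      simp only [Int.even_iff] at hpx hpc
      omega
    have hcb := hc.bounds
    have hxb := hx.bounds
    simp only [abs_le] at hcb hxb
    rcases Relation.ReflTransGen.cases_tail hc with heq | ⟨⟨z1, z2⟩, hz, hzc⟩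
    · simp only [Prod.mk.injEq] at heq
      omega
    have hzb := Connects.bounds hz
    simp only [abs_le] at hzb
    have hzs := hzc.bounds
    simp only [abs_le] at hzs
    rcases hx.cases with ⟨-, hS, hS'⟩ | ⟨⟨y1, y2⟩, hy, hyx⟩
    · simp only at hS hS'
      omega
    have hyb := hy.bounds
    simp only at hyb
    refine Relation.ReflTransGen.tail ?_ hyx
    have hyx' := hyx.2.2
    have hzc' := hzc.2.2
    simp only [Prod.mk.injEq] at hyx' hzc'
    have hys : y1 < n := hyx.bounds.1
    -- The two paths may cross without sharing a site, so the last steps are compared on a common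
    -- level. If a path to `c` jumps over that level, its occupied starting site also has an upward
    -- edge into it; the gap `c + 2 ≤ x` keeps that endpoint at or below `y2`.
    by_cases hyz : y1 = z1
    · subst hyz
      exact IH y1 z2 y2 hys hz hy (by omega)
    · by_cases hyn : y1 = n - 1
      · have h1 : Connects ω (0, 0) (z1 + 1, z2 + 1) :=
          Relation.ReflTransGen.tail hz ⟨hzc.1, hzc.2.1, .inl rfl⟩
        rw [show z1 + 1 = y1 by omega] at h1
        exact IH y1 _ y2 hys h1 hy (by omega)
      · rcases Relation.ReflTransGen.cases_tail hz with heq | ⟨⟨t1, t2⟩, ht, htz⟩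
        · simp only [Prod.mk.injEq] at heq
          omega
        have htz' := htz.2.2
        simp only [Prod.mk.injEq] at htz'
        by_cases hty : t1 = y1
        · subst hty
          exact IH t1 t2 y2 hys ht hy (by omega)
        · have h1 : Connects ω (0, 0) (t1 + 1, t2 + 1) :=
            Relation.ReflTransGen.tail ht ⟨htz.1, htz.2.1, .inl rfl⟩
          rw [show t1 + 1 = y1 by omega] at h1
          exact IH y1 _ y2 hys h1 hy (by omega)

/-- Reflection of a configuration in the time axis. -/
def flip (ω : Config) : Config := fun q => ω (q.1, -q.2)

@[simp] lemma flip_flip (ω : Config) : flip (flip ω) = ω := by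
  ext q
  simp [flip]

lemma Step.flip {ω : Config} {z w : ℤ × ℤ} (h : Step ω z w) :
    Step (flip ω) (z.1, -z.2) (w.1, -w.2) := by
  obtain ⟨⟨h0, h1⟩, ho, h⟩ := h
  refine ⟨⟨h0, ?_⟩, by simpa [OrientedPercolation.flip] using ho, ?_⟩
  · rw [Int.even_iff] at *
    simp only
    omega
  · rcases h with rfl | rfl | rfl <;> simp [Prod.ext_iff] <;> omega

lemma Connects.flip {ω : Config} {z w : ℤ × ℤ} (h : Connects ω z w) :
    Connects (flip ω) (z.1, -z.2) (w.1, -w.2) := by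
  induction h with
  | refl => exact .refl
  | tail _ h ih => exact .tail ih h.flip

/-- The inductive step of a simultaneous induction on the system and its reflection. A predecessor
below the axis lies above a site of the origin's cluster provided by the reflected system, hence
belongs to the cluster by `connects_origin_of_le`. -/
lemma connects_origin_of_stays_step {ω : Config} {n j : ℕ} (hj : j ≤ n)
    (hflip : Stays 0 0 n (flip ω))
    (h₁ : ∀ i < j, ∀ x, 0 ≤ x → Wet ω (halfLine 0 0) ((i : ℤ), x) →
      Connects ω (0, 0) ((i : ℤ), x))
    (h₂ : ∀ i < j, ∀ x, 0 ≤ x → Wet (flip ω) (halfLine 0 0) ((i : ℤ), x) →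
      Connects (flip ω) (0, 0) ((i : ℤ), x))
    {x : ℤ} (hx0 : 0 ≤ x) (hx : Wet ω (halfLine 0 0) ((j : ℤ), x)) :
    Connects ω (0, 0) ((j : ℤ), x) := by
  have hpx := hx.mem_lattice.2
  simp only [Int.even_iff] at hpx
  rcases hx.cases with ⟨-, hS, hS'⟩ | ⟨⟨y1, y2⟩, hy, hyx⟩
  · simp only at hS hS'
    obtain rfl : x = 0 := by omega
    have : (j : ℤ) = 0 := by omega
    rw [this]
    exact .refl
  refine Relation.ReflTransGen.tail ?_ hyx
  have hys := hyx.bounds.1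
  have hyb := hy.bounds
  have hpy := hy.mem_lattice.2
  have hyx' := hyx.2.2
  simp only [Prod.mk.injEq, Int.even_iff] at hyx' hyb hys hpy
  obtain ⟨i, rfl⟩ := Int.eq_ofNat_of_zero_le hyb.1
  by_cases hy0 : 0 ≤ y2
  · exact h₁ i (by omega) y2 hy0 hy
  · obtain ⟨x', hx', hw⟩ := hflip i (by omega)
    rw [zero_add] at hw
    have hpw := hw.mem_lattice.2
    simp only [Int.even_iff] at hpw
    have hc := (h₂ i (by omega) x' hx' hw).flip
    simp only [flip_flip, neg_zero] at hc
    -- Here `y2 = -1`, and parity makes `x'` odd, so `-x' ≤ y2`.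
    exact connects_origin_of_le i _ _ hc hy (by omega)

/-- If the system from below stays above the axis and the system from above stays below it up to
level `n`, then the origin is connected to level `n`. -/
lemma exists_connects_of_stays {ω : Config} {n : ℕ} (h : Stays 0 0 n ω)
    (hflip : Stays 0 0 n (flip ω)) : ∃ x, Connects ω (0, 0) ((n : ℤ), x) := by
  have key : ∀ j ≤ n, (∀ x, 0 ≤ x → Wet ω (halfLine 0 0) ((j : ℤ), x) →
      Connects ω (0, 0) ((j : ℤ), x)) ∧ (∀ x, 0 ≤ x → Wet (flip ω) (halfLine 0 0) ((j : ℤ), x) →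
      Connects (flip ω) (0, 0) ((j : ℤ), x)) := by
    intro j
    induction j using Nat.strong_induction_on with
    | _ j ih =>
      intro hj
      constructor
      · intro x hx0 hx
        exact connects_origin_of_stays_step hj hflip (fun i hi => (ih i hi (by omega)).1)
          (fun i hi => (ih i hi (by omega)).2) hx0 hx
      · intro x hx0 hx
        exact connects_origin_of_stays_step hj (by simpa using h)
          (fun i hi => (ih i hi (by omega)).2)
          (fun i hi => by simpa using (ih i hi (by omega)).1) hx0 hx
  obtain ⟨x, hx, hw⟩ := h n le_rfl
  rw [zero_add] at hw
  exact ⟨x, (key n le_rfl).1 x hx hw⟩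

/-- Translation by a vector of the lattice. -/
lemma Connects.shift {ω : Config} {k v : ℤ} (hkv : Even (k + v)) {z w : ℤ × ℤ}
    (h : Connects ω z w) (hz : k ≤ z.1) :
    Connects (fun q => ω (q.1 + k, q.2 + v)) (z.1 - k, z.2 - v) (w.1 - k, w.2 - v) := by
  induction h with
  | refl => exact .refl
  | @tail y w hy h ih =>
    have hyb := Connects.bounds hy
    obtain ⟨⟨h0, h1⟩, ho, h⟩ := h
    refine .tail ih ⟨⟨?_, ?_⟩, by simpa using ho, ?_⟩
    · simp only
      omega
    · simp only [Int.even_iff] at *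
      omega
    · rcases h with rfl | rfl | rfl <;> simp [Prod.ext_iff] <;> omega

lemma Stays.shift {ω : Config} {k v : ℤ} (hkv : Even (k + v)) {n : ℕ}
    (h : Stays k v n ω) : Stays 0 0 n (fun q => ω (q.1 + k, q.2 + v)) := by
  intro i hi
  obtain ⟨x, hx, s, ⟨hl, hs, hs'⟩, hc⟩ := h i hi
  have h1 := hc.shift hkv (by omega)
  rw [show (k + (i : ℤ), x).1 - k = 0 + i by simp] at h1
  refine ⟨x - v, by omega, _, ⟨⟨?_, ?_⟩, ?_, ?_⟩, h1⟩
  · simp only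
    omega
  · have := hl.2
    simp only [Int.even_iff] at *
    omega
  · simp only
    omega
  · simp only
    omega

lemma Stays.mono {ω ω' : Config} (hω : ω ≤ ω') {k v : ℤ} {n : ℕ} (h : Stays k v n ω) :
    Stays k v n ω' := fun i hi => by
  obtain ⟨x, hx, hw⟩ := h i hi
  exact ⟨x, hx, hw.mono hω⟩

lemma Stays.of_le {ω : Config} {k v : ℤ} {m n : ℕ} (hmn : m ≤ n) (h : Stays k v n ω) :
    Stays k v m ω := fun i hi => h i (hi.trans hmn)

/-! ### Finite-range dependence -/

/-- Only wetness of heights between `v` and `k` matters, and the backward light cones of these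
finitely many sites fill a finite box below level `k`. -/
lemma dependsOn_topAt (k : ℕ) (v : ℤ) :
    DependsOn (TopAt k v)
      (↑(Finset.Ico (0 : ℤ) k ×ˢ Finset.Icc (v - k) (2 * k)) : Set (ℤ × ℤ)) := by
  have key : ∀ ω ω' : Config, (∀ q ∈ (↑(Finset.Ico (0 : ℤ) k ×ˢ Finset.Icc (v - k) (2 * k)) :
      Set (ℤ × ℤ)), ω q = ω' q) → ∀ x, v ≤ x → Wet ω (halfLine 0 0) ((k : ℤ), x) →
      Wet ω' (halfLine 0 0) ((k : ℤ), x) := by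
    intro ω ω' h x hx hw
    have hb := hw.bounds
    refine hw.congr fun q h0 h1 h2 h3 => ?_
    rw [← h q, h3]
    simp only [abs_le] at *
    simp only [Finset.coe_product, Set.mem_prod, Finset.mem_coe, Finset.mem_Ico, Finset.mem_Icc]
    omega
  have key' : ∀ ω ω' : Config, (∀ q ∈ (↑(Finset.Ico (0 : ℤ) k ×ˢ Finset.Icc (v - k) (2 * k)) :
      Set (ℤ × ℤ)), ω q = ω' q) → TopAt k v ω → TopAt k v ω' := by
    intro ω ω' h ht
    refine ⟨key ω ω' h v le_rfl ht.1, fun x hx => ?_⟩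
    by_contra hvx
    exact hvx (ht.2 (key ω' ω (fun q hq => (h q hq).symm) x (not_le.1 hvx).le hx))
  exact fun ω ω' h => propext ⟨key' ω ω' h, key' ω' ω fun q hq => (h q hq).symm⟩

lemma dependsOn_stays (k v : ℤ) (n : ℕ) :
    DependsOn (Stays k v n)
      (↑(Finset.Ico k (k + n) ×ˢ Finset.Icc (v - n) (v + 2 * n)) : Set (ℤ × ℤ)) := by
  have key : ∀ ω ω' : Config, (∀ q ∈ (↑(Finset.Ico k (k + n) ×ˢ Finset.Icc (v - n) (v + 2 * n)) :
      Set (ℤ × ℤ)), ω q = ω' q) → Stays k v n ω → Stays k v n ω' := by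
    intro ω ω' h hs i hi
    obtain ⟨x, hx, hw⟩ := hs i hi
    have hb := hw.bounds
    refine ⟨x, hx, hw.congr fun q h0 h1 h2 h3 => ?_⟩
    rw [← h q, h3]
    simp only [abs_le] at *
    simp only [Finset.coe_product, Set.mem_prod, Finset.mem_coe, Finset.mem_Ico, Finset.mem_Icc]
    omega
  exact fun ω ω' h => propext ⟨key ω ω' h, key ω' ω fun q hq => (h q hq).symm⟩

/-- The box is wider than necessary so that it also contains the one for the unreflected event, as
`harris` asks for a common set of coordinates. -/
lemma dependsOn_stays_flip (n : ℕ) :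
    DependsOn (fun ω => Stays 0 0 n (flip ω))
      (↑(Finset.Ico (0 : ℤ) n ×ˢ Finset.Icc (-2 * n : ℤ) (2 * n)) : Set (ℤ × ℤ)) := by
  intro ω ω' h
  refine dependsOn_stays 0 0 n fun q hq => h _ ?_
  simp only [Finset.coe_product, Set.mem_prod, Finset.mem_coe, Finset.mem_Ico,
    Finset.mem_Icc] at hq ⊢
  omega

/-! ### Events that depend on finitely many sites -/

section FiniteRange

variable {ι : Type*}

lemma exists_restrict_preimage {P : (ι → Bool) → Prop} {S : Finset ι}
    (hP : DependsOn P (S : Set ι)) :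
    ∃ A : Set (S → Bool), {ω | P ω} = S.restrict ⁻¹' A := by
  refine ⟨S.restrict '' {ω | P ω}, Set.Subset.antisymm (Set.subset_preimage_image _ _) ?_⟩
  rintro ω ⟨ω', h', h⟩
  have : P ω' = P ω := hP fun i hi => congrFun h ⟨i, hi⟩
  exact cast this h'

lemma measurableSet_of_dependsOn {P : (ι → Bool) → Prop} {S : Finset ι}
    (hP : DependsOn P (S : Set ι)) : MeasurableSet {ω | P ω} := by
  obtain ⟨A, hA⟩ := exists_restrict_preimage hP
  rw [hA]
  exact S.measurable_restrict A.toFinite.measurableSet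

lemma measure_inter_of_dependsOn (μ : ι → Measure Bool) [∀ i, IsProbabilityMeasure (μ i)]
    {P Q : (ι → Bool) → Prop} {S T : Finset ι} (hST : Disjoint S T)
    (hP : DependsOn P (S : Set ι)) (hQ : DependsOn Q (T : Set ι)) :
    Measure.infinitePi μ {ω | P ω ∧ Q ω} =
      Measure.infinitePi μ {ω | P ω} * Measure.infinitePi μ {ω | Q ω} := by
  obtain ⟨A, hA⟩ := exists_restrict_preimage hP
  obtain ⟨B, hB⟩ := exists_restrict_preimage hQ
  rw [Set.ofPred_and, hA, hB]
  have h := (ProbabilityTheory.iIndepFun_infinitePi (P := μ) (X := fun _ x => x)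
    (fun _ => measurable_id)).indepFun_finset S T hST (fun i => measurable_pi_apply i)
  exact h.measure_inter_preimage_eq_mul A B A.toFinite.measurableSet B.toFinite.measurableSet

/-- **Harris' inequality** for increasing events that depend on finitely many coordinates. -/
lemma harris (μ : ι → Measure Bool) [∀ i, IsProbabilityMeasure (μ i)]
    {P Q : (ι → Bool) → Prop} {S : Finset ι}
    (hP : DependsOn P (S : Set ι)) (hQ : DependsOn Q (S : Set ι))
    (hPm : Monotone P) (hQm : Monotone Q) :
    Measure.infinitePi μ {ω | P ω} * Measure.infinitePi μ {ω | Q ω} ≤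
      Measure.infinitePi μ {ω | P ω ∧ Q ω} := by
  classical
  let ext : (S → Bool) → ι → Bool := fun x i => if h : i ∈ S then x ⟨i, h⟩ else false
  have hext : Monotone ext := fun x y hxy i => by
    by_cases h : i ∈ S <;> simp [ext, h, hxy ⟨i, _⟩]
  have hprob : ∀ R : (ι → Bool) → Prop, DependsOn R (S : Set ι) →
      (Measure.infinitePi μ).real {ω | R ω} =
        ∑ x : S → Bool, (∏ i : S, (μ i).real {x i}) * (if R (ext x) then 1 else 0) := by
    intro R hR
    have h1 : {ω | R ω} = S.restrict ⁻¹' {x | R (ext x)} := by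
      ext ω
      have : R ω = R (ext (S.restrict ω)) := hR fun i hi => by
        simp [ext, Finset.mem_coe.1 hi]
      simp [this]
    have hm : ∀ A : Set (S → Bool), MeasurableSet A := fun A => A.toFinite.measurableSet
    rw [h1, measureReal_def, ← Measure.map_apply S.measurable_restrict (hm _),
      Measure.infinitePi_map_restrict, ← measureReal_def]
    have h2 : {x | R (ext x)} = ↑(Finset.univ.filter fun x : S → Bool => R (ext x)) := by
      ext x; simp
    rw [h2, ← sum_measureReal_singleton, Finset.sum_filter]
    refine Finset.sum_congr rfl fun x _ => ?_
    split_ifs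
    · simp [measureReal_def, Measure.pi_singleton, ENNReal.toReal_prod]
    · simp
  have hfkg := fkg (α := S → Bool) (β := ℝ) (μ := fun x => ∏ i : S, (μ i).real {x i})
    (f := fun x => if P (ext x) then 1 else 0) (g := fun x => if Q (ext x) then 1 else 0)
    (fun x => Finset.prod_nonneg fun _ _ => measureReal_nonneg)
    (fun x => by dsimp only; split_ifs <;> simp) (fun x => by dsimp only; split_ifs <;> simp)
    (fun x y hxy => ?_) (fun x y hxy => ?_) (fun x y => ?_)
  · rw [← hprob P hP, ← hprob Q hQ] at hfkg
    have htot : ∑ x : S → Bool, ∏ i : S, (μ i).real {x i} = 1 := by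
      simpa using (hprob (fun _ => True) (fun _ _ _ => rfl)).symm
    have hPQ : ∑ x : S → Bool, (∏ i : S, (μ i).real {x i}) *
        ((if P (ext x) then 1 else 0) * (if Q (ext x) then 1 else 0)) =
        (Measure.infinitePi μ).real {ω | P ω ∧ Q ω} := by
      rw [hprob (fun ω => P ω ∧ Q ω) fun ω ω' h => by simp only [hP h, hQ h]]
      refine Finset.sum_congr rfl fun x _ => ?_
      by_cases h1 : P (ext x) <;> by_cases h2 : Q (ext x) <;> simp [h1, h2]
    rw [htot, hPQ, one_mul] at hfkg
    rw [← ENNReal.toReal_le_toReal (by finiteness) (by finiteness), ENNReal.toReal_mul]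
    exact hfkg
  · have : P (ext x) → P (ext y) := hPm (hext hxy)
    by_cases h : P (ext x)
    · simp [h, this h]
    · simp only [h, if_false]
      split_ifs <;> simp
  · have : Q (ext x) → Q (ext y) := hQm (hext hxy)
    by_cases h : Q (ext x)
    · simp [h, this h]
    · simp only [h, if_false]
      split_ifs <;> simp
  -- For a product weight the FKG lattice condition is an equality, coordinate by coordinate.
  · rw [← Finset.prod_mul_distrib, ← Finset.prod_mul_distrib]
    refine le_of_eq (Finset.prod_congr rfl fun i _ => ?_)
    rw [Pi.inf_apply, Pi.sup_apply]
    cases x i <;> cases y i <;> simp [mul_comm]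

end FiniteRange

/-! ### The law of the upper edge -/

variable (p : unitInterval)

lemma siteLaw_map_reindex {f : ℤ × ℤ → ℤ × ℤ} (hf : Function.Injective f) :
    (siteLaw p).map (fun ω i => ω (f i)) = siteLaw p :=
  Measure.map_infinitePi_infinitePi_of_inj hf

lemma siteLaw_reindex {f : ℤ × ℤ → ℤ × ℤ} (hf : Function.Injective f) {P : Config → Prop}
    (hP : MeasurableSet {ω | P ω}) : siteLaw p {ω | P fun i => ω (f i)} = siteLaw p {ω | P ω} := by
  conv_rhs => rw [← siteLaw_map_reindex p hf, Measure.map_apply (by fun_prop) hP]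
  rfl

lemma measurableSet_stays (k v : ℤ) (n : ℕ) : MeasurableSet {ω | Stays k v n ω} :=
  measurableSet_of_dependsOn (dependsOn_stays k v n)

lemma siteLaw_stays_flip (n : ℕ) :
    siteLaw p {ω | Stays 0 0 n (flip ω)} = siteLaw p {ω | Stays 0 0 n ω} :=
  siteLaw_reindex p (f := fun q => (q.1, -q.2)) (fun a b h => by simpa [Prod.ext_iff] using h)
    (measurableSet_stays 0 0 n)

lemma siteLaw_stays_le {k v : ℤ} (hkv : Even (k + v)) (n : ℕ) :
    siteLaw p {ω | Stays k v n ω} ≤ siteLaw p {ω | Stays 0 0 n ω} := by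
  rw [← siteLaw_reindex p (f := fun q => (q.1 + k, q.2 + v))
    (fun a b h => by simpa [Prod.ext_iff] using h) (measurableSet_stays 0 0 n)]
  exact measure_mono fun ω h => Stays.shift hkv h

lemma siteLaw_sq_le (n : ℕ) : siteLaw p {ω | Stays 0 0 n ω} ^ 2 ≤
    siteLaw p {ω | Stays 0 0 n ω ∧ Stays 0 0 n (flip ω)} := by
  have hsub : (↑(Finset.Ico (0 : ℤ) (0 + n) ×ˢ Finset.Icc (0 - n : ℤ) (0 + 2 * n)) :
      Set (ℤ × ℤ)) ⊆ ↑(Finset.Ico (0 : ℤ) n ×ˢ Finset.Icc (-2 * n : ℤ) (2 * n)) := by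
    intro q hq
    simp only [Finset.coe_product, Set.mem_prod, Finset.mem_coe, Finset.mem_Ico,
      Finset.mem_Icc] at hq ⊢
    omega
  have h := harris (fun _ => ProbabilityTheory.bernoulliMeasure true false p)
    ((dependsOn_stays 0 0 n).mono hsub) (dependsOn_stays_flip n) (fun _ _ h hs => hs.mono h)
    (fun _ _ h hs => hs.mono fun q => h _)
  rw [pow_two]
  nth_rewrite 2 [← siteLaw_stays_flip]
  exact h

/-- The event that the upper edge has a last exit at level `k`. -/
def lastExit (k n : ℕ) : Set Config := ⋃ v : ℤ, {ω | TopAt k v ω ∧ Stays k v n ω}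

lemma measurableSet_topAt (k : ℕ) (v : ℤ) : MeasurableSet {ω | TopAt k v ω} :=
  measurableSet_of_dependsOn (dependsOn_topAt k v)

lemma measurableSet_lastExit (k n : ℕ) : MeasurableSet (lastExit k n) :=
  .iUnion fun v => (measurableSet_topAt k v).inter (measurableSet_stays k v n)

/-- Decompose over the height `v` of the edge at level `k`: it is determined by levels before `k`,
the future by levels from `k` on, and the events for different `v` are disjoint. -/
lemma siteLaw_lastExit_le (k n : ℕ) :
    siteLaw p (lastExit k n) ≤ siteLaw p {ω | Stays 0 0 n ω} := by
  have hv : ∀ v : ℤ, siteLaw p {ω | TopAt k v ω ∧ Stays k v n ω} ≤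
      siteLaw p {ω | TopAt k v ω} * siteLaw p {ω | Stays 0 0 n ω} := by
    intro v
    by_cases hkv : Even ((k : ℤ) + v)
    · have hd : Disjoint (Finset.Ico (0 : ℤ) k ×ˢ Finset.Icc (v - k) (2 * k))
          (Finset.Ico (k : ℤ) (k + n) ×ˢ Finset.Icc (v - n) (v + 2 * n)) := by
        rw [Finset.disjoint_left]
        intro q hq hq'
        simp only [Finset.mem_product, Finset.mem_Ico, Finset.mem_Icc] at hq hq'
        omega
      refine (measure_inter_of_dependsOn _ hd (dependsOn_topAt k v)
        (dependsOn_stays k v n)).le.trans ?_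
      exact mul_le_mul_right (siteLaw_stays_le p hkv n) _
    · have : {ω | TopAt k v ω ∧ Stays k v n ω} = ∅ := by
        ext ω
        exact ⟨fun h => hkv h.1.1.mem_lattice.2, fun h => h.elim⟩
      simp [this]
  refine (measure_iUnion_le _).trans ((ENNReal.tsum_le_tsum hv).trans ?_)
  rw [ENNReal.tsum_mul_right, ← measure_iUnion (fun v w hvw => ?_) (measurableSet_topAt k)]
  · exact (mul_le_mul_left prob_le_one _).trans (one_mul _).le
  · exact Set.disjoint_left.2 fun ω h h' => hvw (IsGreatest.unique h h')

lemma toENNReal_upperEdge_div_le {N : ℕ} (ω : Config) :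
    (upperEdge N ω / ((N : ℝ) : EReal)).toENNReal ≤
      (N : ℝ≥0∞)⁻¹ * ∑ k ∈ Finset.range N, (lastExit k (N - k)).indicator 1 ω := by
  classical
  let s := (Finset.range N).filter fun k => ω ∈ lastExit k (N - k)
  have hs : ∑ k ∈ Finset.range N, (lastExit k (N - k)).indicator 1 ω = (s.card : ℝ≥0∞) := by
    simp [s, Set.indicator_apply, Finset.sum_boole]
  have hle : upperEdge N ω ≤ ((s.card : ℝ) : EReal) := by
    refine iSup₂_le fun x hx => ?_
    rw [reachedFromBelow_eq] at hx
    have := le_card_topAt_stays hx s fun k hk v ht hst =>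
      Finset.mem_filter.2 ⟨Finset.mem_range.2 hk, Set.mem_iUnion.2 ⟨v, ht, hst⟩⟩
    exact_mod_cast this
  rcases N.eq_zero_or_pos with rfl | hN
  · simp
  have hN' : (0 : ℝ) < N := by exact_mod_cast hN
  rw [hs]
  refine (EReal.toENNReal_le_toENNReal (EReal.div_le_div_right_of_nonneg
    (EReal.coe_nonneg.2 hN'.le) hle)).trans ?_
  rw [← EReal.coe_div, EReal.toENNReal_of_ne_top (EReal.coe_ne_top _), EReal.toReal_coe,
    ENNReal.ofReal_div_of_pos hN', ENNReal.ofReal_natCast, ENNReal.ofReal_natCast,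
    ENNReal.div_eq_inv_mul]

lemma extExpectation_upperEdge_le (N : ℕ) :
    extExpectation (siteLaw p) (fun ω => upperEdge N ω / ((N : ℝ) : EReal)) ≤
      (((N : ℝ≥0∞)⁻¹ * ∑ k ∈ Finset.range N, siteLaw p {ω | Stays 0 0 (N - k) ω} : ℝ≥0∞) :
        EReal) := by
  -- The negative part only lowers the expectation and is dropped.
  refine (EReal.sub_le_sub le_rfl (EReal.coe_ennreal_nonneg _)).trans ?_
  rw [sub_zero, EReal.coe_ennreal_le_coe_ennreal_iff]
  refine (lintegral_mono toENNReal_upperEdge_div_le).trans ?_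
  rw [lintegral_const_mul _ (Finset.measurable_fun_sum _ fun k _ =>
    measurable_one.indicator (measurableSet_lastExit k _)),
    lintegral_finsetSum _ fun k _ => measurable_one.indicator (measurableSet_lastExit k _)]
  refine mul_le_mul_right (Finset.sum_le_sum fun k _ => ?_) _
  rw [lintegral_indicator_one (measurableSet_lastExit k _)]
  exact siteLaw_lastExit_le p k _

/-- An antitone sequence whose averages are all at least `a` is bounded below by `a`. -/
lemma le_of_antitone_of_le_average {g : ℕ → ℝ} (hg : Antitone g) {a : ℝ}
    (h : ∀ N : ℕ, a * N ≤ ∑ k ∈ Finset.range N, g (N - k)) (m : ℕ) : a ≤ g m := by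
  by_contra hlt
  push Not at hlt
  -- Among `m + n` terms, `m` are bounded by `g 0` and the rest by `g m`; if `g m < a`, this fails
  -- for large `n`.
  have hsum : ∀ n : ℕ, a * ((m + n : ℕ) : ℝ) ≤ m * g 0 + n * g m := fun n => by
    refine (h (m + n)).trans ?_
    rw [add_comm m n, Finset.sum_range_add, add_comm]
    refine add_le_add ?_ ?_
    · exact (Finset.sum_le_card_nsmul _ _ _ fun k _ => hg (Nat.zero_le _)).trans (by simp)
    · refine (Finset.sum_le_card_nsmul _ _ (g m) fun k hk => hg ?_).trans (by simp)
      have := Finset.mem_range.1 hk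
      omega
  obtain ⟨n, hn⟩ := exists_nat_gt ((m * g 0 - a * m) / (a - g m))
  rw [div_lt_iff₀ (by linarith)] at hn
  have := hsum n
  push_cast at this
  nlinarith

/-- A positive edge speed bounds the probability that the upper edge stays nonnegative. -/
lemma exists_le_siteLaw_stays (hα : 0 < edgeSpeed p) :
    ∃ a : ℝ, 0 < a ∧ ∀ n, a ≤ (siteLaw p).real {ω | Stays 0 0 n ω} := by
  obtain ⟨a, ha, haα⟩ := EReal.lt_iff_exists_real_btwn.1 hα
  refine ⟨a, by exact_mod_cast ha, le_of_antitone_of_le_average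
    (g := fun n => (siteLaw p).real {ω | Stays 0 0 n ω})
    (fun m n hmn => measureReal_mono fun ω h => Stays.of_le hmn h) fun N => ?_⟩
  rcases N.eq_zero_or_pos with rfl | hN
  · simp
  have h1 := haα.le.trans ((iInf₂_le N hN).trans (extExpectation_upperEdge_le p N))
  have hN' : (0 : ℝ) < N := by exact_mod_cast hN
  have hfin : (N : ℝ≥0∞)⁻¹ * ∑ k ∈ Finset.range N, siteLaw p {ω | Stays 0 0 (N - k) ω} ≠ ∞ :=
    ENNReal.mul_ne_top (by simp; omega) (ENNReal.sum_ne_top.2 fun _ _ => by finiteness)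
  rw [← ENNReal.ofReal_toReal hfin, EReal.coe_ennreal_ofReal, EReal.coe_le_coe_iff,
    max_eq_left ENNReal.toReal_nonneg, ENNReal.toReal_mul,
    ENNReal.toReal_sum fun _ _ => by finiteness, ENNReal.toReal_inv, ENNReal.toReal_natCast,
    inv_mul_eq_div, le_div_iff₀ hN'] at h1
  exact h1

lemma infinite_forwardCluster_of_stays {ω : Config}
    (h : ∀ n, Stays 0 0 n ω ∧ Stays 0 0 n (flip ω)) : (forwardCluster ω (0, 0)).Infinite := by
  choose x hx using fun n => exists_connects_of_stays (h n).1 (h n).2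
  exact Set.infinite_of_injective_forall_mem (f := fun n : ℕ => ((n : ℤ), x n))
    (fun m n hmn => by simpa using (Prod.ext_iff.1 hmn).1) hx

end OrientedPercolation

open OrientedPercolation in
theorem mainTheorem11 (p : unitInterval) (hα : 0 < OrientedPercolation.edgeSpeed p) :
    0 < OrientedPercolation.siteLaw p
      {ω | (OrientedPercolation.forwardCluster ω (0, 0)).Infinite} := by
  obtain ⟨a, ha, h⟩ := exists_le_siteLaw_stays p hα
  have hle : ∀ n, ENNReal.ofReal a ^ 2 ≤
      siteLaw p {ω | Stays 0 0 n ω ∧ Stays 0 0 n (flip ω)} := fun n => by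
    refine le_trans ?_ (siteLaw_sq_le p n)
    gcongr
    exact (ENNReal.ofReal_le_iff_le_toReal (by finiteness)).2 (h n)
  have hlim := tendsto_measure_iInter_atTop (μ := siteLaw p)
    (s := fun n : ℕ => {ω | Stays 0 0 n ω ∧ Stays 0 0 n (flip ω)})
    (fun n => ((measurableSet_stays 0 0 n).inter
      (measurableSet_of_dependsOn (dependsOn_stays_flip n))).nullMeasurableSet)
    (fun m n hmn ω hω => ⟨hω.1.of_le hmn, hω.2.of_le hmn⟩) ⟨0, by finiteness⟩
  refine lt_of_lt_of_le ?_ ((ge_of_tendsto' hlim hle).trans (measure_mono fun ω hω =>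
    infinite_forwardCluster_of_stays fun n => Set.mem_iInter.1 hω n))
  exact ENNReal.pow_pos (ENNReal.ofReal_pos.2 ha) 2
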